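/- Let $\Omega\subset\mathbb R^2$ be a bounded simply connected open set with $C^\infty$-smooth boundary $\Sigma=\partial\Omega$, and put $\Omega_+=\Omega$, $\Omega_-=\mathbb R^2\setminus\overline{\Omega}$. Let $\mathbf n=(n_1,n_2)$ be the unit normal on $\Sigma$ pointing out of $\Omega_+$, $\mathbf t=(-n_2,n_1)$, let $\sigma_1,\sigma_2,\sigma_3$ be the Pauli matrices and $\sigma\cdot a=\sigma_1a_1+\sigma_2a_2$. Let $m\in\mathbb R$ and $D_0=-i(\sigma_1\partial_1+\sigma_2\partial_2)+m\sigma_3$. For an open set $U$ let $H(\sigma,U)=\{f\in L^2(U;\mathbb C^2): \sigma\cdot\nabla f\in L^2(U;\mathbb C^2)\}$, with the graph norm and with derivatives in the sense of distributions. Let $\mathcal T^D_\pm: H(\sigma,\Omega_\pm)\to H^{-1/2}(\Sigma;\mathbb C^2)$ be the Dirichlet trace, that is, the continuous extension of the restriction to $\Sigma$ of functions smooth up to the boundary. For $\eta,\tau,\lambda\in C^\infty(\Sigma;\mathbb R)$ let $\mathscr D_{\eta,\tau,\lambda}$ be the operator in $L^2(\mathbb R^2;\mathbb C^2)=L^2(\Omega_+;\mathbb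 C^2)\oplus L^2(\Omega_-;\mathbb C^2)$ with action $f_+\oplus f_-\mapsto D_0f_+\oplus D_0f_-$ on the domain of all $f_+\oplus f_-\in H(\sigma,\Omega_+)\oplus H(\sigma,\Omega_-)$ such that, in $H^{-1/2}(\Sigma;\mathbb C^2)$, $$ i(\sigma\cdot\mathbf n)(\mathcal T^D_-f_--\mathcal T^D_+f_+)=\tfrac12\big(\eta\,\mathbb I_2+\tau\sigma_3+\lambda(\sigma\cdot\mathbf t)\big)(\mathcal T^D_-f_-+\mathcal T^D_+f_+). $$ Let $\mathscr D^{\pm}_{\eta,\tau,\lambda}$ be the operator $f_\pm\mapsto D_0f_\pm$ in $L^2(\Omega_\pm;\mathbb C^2)$ on the domain $$ \Big\{f_\pm\in H(\sigma,\Omega_\pm):\ \big[\pm i(\sigma\cdot\mathbf n)+\tfrac12(\eta\,\mathbb I_2+\tau\sigma_3+\lambda(\sigma\cdot\mathbf t))\big]\mathcal T^D_\pm f_\pm=0\Big\}. $$ (i) If $\eta^2-\tau^2-\lambda^2=-4$ everywhere on $\Sigma$, then $\mathscr D_{\eta,\tau,\lambda}$ is the orthogonal sum $\mathscr D^+_{\eta,\tau,\lambda}\oplus\mathscr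 D^-_{\eta,\tau,\lambda}$ (equality of operators, including domains). (ii) Every quantum-dot boundary condition on $\Omega_+$ arises in this way: for every $\theta\in C^\infty(\Sigma;\mathbb R)$ the triple $(\eta,\tau,\lambda)=(0,2\cos\theta,-2\sin\theta)$ satisfies $\eta^2-\tau^2-\lambda^2=-4$, and $\mathscr D^+_{\eta,\tau,\lambda}$ is the operator $f_+\mapsto D_0f_+$ on the domain of all $f_+\in H(\sigma,\Omega_+)$ with $[\mathbb I_2-\cos\theta\,(\sigma\cdot\mathbf t)-\sin\theta\,\sigma_3]\mathcal T^D_+f_+=0$. (iii) In particular the zig-zag conditions arise: the domain of $\mathscr D^+_{0,0,2}$ consists of the $f\in H(\sigma,\Omega_+)$ for which the first component of $\mathcal T^D_+f$ vanishes, and the domain of $\mathscr D^+_{0,0,-2}$ of those for which the second component of $\mathcal T^D_+f$ vanishes. -/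

import Mathlib

open MeasureTheory Set Filter Topology
open scoped ContDiff Distributions ENNReal Matrix

noncomputable section

namespace DeltaShell

/-- The Euclidean plane. -/
abbrev Plane := EuclideanSpace ℝ (Fin 2)

/-- The space of spinors. -/
abbrev Spinor := EuclideanSpace ℂ (Fin 2)

/-! ### Pauli matrices -/

/-- The first Pauli matrix. -/
def pauli₁ : Matrix (Fin 2) (Fin 2) ℂ := !![0, 1; 1, 0]

/-- The second Pauli matrix. -/
def pauli₂ : Matrix (Fin 2) (Fin 2) ℂ := !![0, -Complex.I; Complex.I, 0]

/-- The third Pauli matrix. -/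
def pauli₃ : Matrix (Fin 2) (Fin 2) ℂ := !![1, 0; 0, -1]

/-- A constant matrix as an operator on spinors. -/
abbrev act (A : Matrix (Fin 2) (Fin 2) ℂ) : Spinor →L[ℂ] Spinor :=
  Matrix.toEuclideanCLM (n := Fin 2) (𝕜 := ℂ) A

/-! ### The Dirac expression on an open set, in the sense of distributions -/

/-- `L²(U; ℂ²)`. -/
abbrev L2 (U : TopologicalSpace.Opens Plane) := Lp Spinor 2 (volume.restrict (U : Set Plane))

variable {U : TopologicalSpace.Opens Plane}

/-- The first (`j = 0`) or second (`j = 1`) partial derivative of a test function. -/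
def partialDeriv (j : Fin 2) (φ : Plane → ℝ) (x : Plane) : ℝ :=
  fderiv ℝ φ x (EuclideanSpace.single j 1)

/-- `σ · ∇ f = g` on `U` in the sense of distributions, where
`σ · ∇ = σ₁ ∂₁ + σ₂ ∂₂`. -/
def IsSigmaGrad (f g : L2 U) : Prop :=
  ∀ φ : 𝓓(U, ℝ),
    ∫ x in U, φ x • g x =
      -∫ x in U, (partialDeriv 0 φ x • act pauli₁ (f x) + partialDeriv 1 φ x • act pauli₂ (f x))

lemma integrable_smul (f : L2 U) (A : Spinor →L[ℂ] Spinor) {φ : Plane → ℝ}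
    (hc : Continuous φ) (hs : HasCompactSupport φ) :
    Integrable (fun x => φ x • A (f x)) (volume.restrict (U : Set Plane)) := by
  have h : MemLp (fun x => A (f x)) 2 (volume.restrict (U : Set Plane)) :=
    A.comp_memLp' (Lp.memLp f)
  exact (h.locallyIntegrable (by norm_num)).integrable_smul_left_of_hasCompactSupport hc hs

lemma continuous_partialDeriv (j : Fin 2) (φ : 𝓓(U, ℝ)) : Continuous (partialDeriv j φ) := by
  have h := (φ.contDiff.continuous_fderiv (by simp))
  exact h.clm_apply continuous_const

lemma hasCompactSupport_partialDeriv (j : Fin 2) (φ : 𝓓(U, ℝ)) :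
    HasCompactSupport (partialDeriv j φ) :=
  (φ.hasCompactSupport.fderiv (𝕜 := ℝ)).comp_left
    (g := fun L : Plane →L[ℝ] ℝ => L (EuclideanSpace.single j 1)) (by simp)

lemma IsSigmaGrad.add {f g f' g' : L2 U} (h : IsSigmaGrad f g) (h' : IsSigmaGrad f' g') :
    IsSigmaGrad (f + f') (g + g') := by
  intro φ
  have i1 := integrable_smul g (.id ℂ _) φ.continuous φ.hasCompactSupport
  have i2 := integrable_smul g' (.id ℂ _) φ.continuous φ.hasCompactSupport
  have p (j A) (f : L2 U) := integrable_smul f (act A) (continuous_partialDeriv j φ)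
    (hasCompactSupport_partialDeriv j φ)
  simp only [ContinuousLinearMap.id_apply] at i1 i2
  have e1 : ∫ x in U, φ x • (g + g' : L2 U) x = ∫ x in U, (φ x • g x + φ x • g' x) := by
    apply integral_congr_ae
    filter_upwards [Lp.coeFn_add g g'] with x hx
    rw [hx, Pi.add_apply, smul_add]
  have e2 : ∫ x in U, (partialDeriv 0 φ x • act pauli₁ ((f + f' : L2 U) x)
        + partialDeriv 1 φ x • act pauli₂ ((f + f' : L2 U) x)) =
      ∫ x in U, ((partialDeriv 0 φ x • act pauli₁ (f x) + partialDeriv 1 φ x • act pauli₂ (f x))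
        + (partialDeriv 0 φ x • act pauli₁ (f' x) + partialDeriv 1 φ x • act pauli₂ (f' x))) := by
    apply integral_congr_ae
    filter_upwards [Lp.coeFn_add f f'] with x hx
    rw [hx, Pi.add_apply, map_add, map_add]
    module
  have e3 := integral_add ((p 0 pauli₁ f).add (p 1 pauli₂ f))
    ((p 0 pauli₁ f').add (p 1 pauli₂ f'))
  simp only [Pi.add_apply] at e3
  rw [e1, e2, integral_add i1 i2, e3, h φ, h' φ, neg_add]

lemma IsSigmaGrad.smul {f g : L2 U} (c : ℂ) (h : IsSigmaGrad f g) :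
    IsSigmaGrad (c • f) (c • g) := by
  intro φ
  have e1 : ∫ x in U, φ x • (c • g : L2 U) x = ∫ x in U, c • (φ x • g x) := by
    apply integral_congr_ae
    filter_upwards [Lp.coeFn_smul c g] with x hx
    rw [hx, Pi.smul_apply, smul_comm]
  have e2 : ∫ x in U, (partialDeriv 0 φ x • act pauli₁ ((c • f : L2 U) x)
        + partialDeriv 1 φ x • act pauli₂ ((c • f : L2 U) x)) =
      ∫ x in U, c • (partialDeriv 0 φ x • act pauli₁ (f x)
        + partialDeriv 1 φ x • act pauli₂ (f x)) := by
    apply integral_congr_ae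
    filter_upwards [Lp.coeFn_smul c f] with x hx
    rw [hx, Pi.smul_apply, map_smul, map_smul, smul_add, smul_comm c, smul_comm c]
  rw [e1, e2, integral_smul, integral_smul, h φ, smul_neg]

lemma IsSigmaGrad.zero : IsSigmaGrad (0 : L2 U) 0 := by
  intro φ
  have z : ((0 : L2 U) : Plane → Spinor) =ᵐ[volume.restrict (U : Set Plane)] 0 :=
    Lp.coeFn_zero _ _ _
  have e1 : ∫ x in U, φ x • (0 : L2 U) x = 0 := by
    apply integral_eq_zero_of_ae
    filter_upwards [z] with x hx
    simp only [hx, Pi.zero_apply, smul_zero]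
  have e2 : ∫ x in U, (partialDeriv 0 φ x • act pauli₁ ((0 : L2 U) x)
        + partialDeriv 1 φ x • act pauli₂ ((0 : L2 U) x)) = 0 := by
    apply integral_eq_zero_of_ae
    filter_upwards [z] with x hx
    simp only [hx, Pi.zero_apply, map_zero, smul_zero, add_zero]
  rw [e1, e2, neg_zero]

lemma IsSigmaGrad.unique {f g g' : L2 U} (h : IsSigmaGrad f g) (h' : IsSigmaGrad f g') :
    g = g' := by
  have hd : IsSigmaGrad (f + (-1 : ℂ) • f) (g + (-1 : ℂ) • g') := h.add (h'.smul _)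
  have hf : f + (-1 : ℂ) • f = 0 := by module
  rw [hf] at hd
  set k := g + (-1 : ℂ) • g' with hk
  have hz : ∀ φ : 𝓓(U, ℝ), ∫ x in U, φ x • k x = 0 := by
    intro φ
    rw [hd φ, ← IsSigmaGrad.zero φ]
    apply integral_eq_zero_of_ae
    filter_upwards [Lp.coeFn_zero Spinor 2 (volume.restrict (U : Set Plane))] with x hx
    simp only [hx, Pi.zero_apply, smul_zero]
  have hae : ∀ᵐ x ∂(volume.restrict (U : Set Plane)), x ∈ (U : Set Plane) → k x = 0 := by
    apply U.isOpen.ae_eq_zero_of_integral_contDiff_smul_eq_zero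
    · exact ((Lp.memLp k).locallyIntegrable (by norm_num)).locallyIntegrableOn _
    · intro φ hφ hs ht
      exact hz ⟨φ, hφ, hs, ht⟩
  have hk0 : k = 0 := by
    rw [Lp.eq_zero_iff_ae_eq_zero]
    filter_upwards [hae, ae_restrict_mem U.isOpen.measurableSet] with x hx hxU
    exact hx hxU
  have : g - g' = 0 := by rw [← hk0, hk]; module
  exact sub_eq_zero.mp this

/-- `H(σ, U) = {f ∈ L²(U; ℂ²) : σ · ∇ f ∈ L²(U; ℂ²)}`. -/
def HSigma (U : TopologicalSpace.Opens Plane) : Submodule ℂ (L2 U) where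
  carrier := {f | ∃ g : L2 U, IsSigmaGrad f g}
  add_mem' := fun ⟨g, hg⟩ ⟨g', hg'⟩ => ⟨g + g', hg.add hg'⟩
  zero_mem' := ⟨0, IsSigmaGrad.zero⟩
  smul_mem' := fun c _ ⟨g, hg⟩ => ⟨c • g, hg.smul c⟩

/-- `f ↦ σ · ∇ f` from `H(σ, U)` to `L²(U; ℂ²)`. -/
def sigmaGrad (U : TopologicalSpace.Opens Plane) : HSigma U →ₗ[ℂ] L2 U where
  toFun f := f.2.choose
  map_add' f f' := IsSigmaGrad.unique (f + f').2.choose_spec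
    (f.2.choose_spec.add f'.2.choose_spec)
  map_smul' c f := IsSigmaGrad.unique (c • f).2.choose_spec (f.2.choose_spec.smul c)

/-- The differential expression `D₀ f = -i σ · ∇ f + m σ₃ f` for `f ∈ H(σ, U)`. -/
def diracExpr (m : ℝ) (U : TopologicalSpace.Opens Plane) : HSigma U →ₗ[ℂ] L2 U :=
  (-Complex.I) • sigmaGrad U +
    (m : ℂ) • (((act pauli₃).compLpL 2 (volume.restrict (U : Set Plane))).toLinearMap ∘ₗ
      (HSigma U).subtype)

/-! ### The shell -/

/-- A smooth, positively oriented arc-length parametrization of the boundary of the planar open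
set `Ω`, as a map on `ℝ / ℓℤ`; its existence expresses that `Ω` has a `C^∞`-smooth boundary
consisting of one closed curve. -/
structure Shell (Ω : TopologicalSpace.Opens Plane) where
  /-- the length `ℓ` of the curve -/
  len : ℝ
  len_pos : 0 < len
  /-- the parametrization, lifted to `ℝ` -/
  γ : ℝ → Plane
  contDiff : ContDiff ℝ ∞ γ
  norm_deriv : ∀ s, ‖deriv γ s‖ = 1
  eq_iff : ∀ s t, γ s = γ t ↔ ∃ k : ℤ, t = s + k * len
  range_eq : range γ = frontier (Ω : Set Plane)
  /-- `(γ₂', -γ₁')` points from `Ω` to the exterior of `Ω`. -/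
  outward : ∀ s, ∀ᶠ p : ℝ in 𝓝[>] 0,
    γ s - p • !₂[deriv γ s 1, -deriv γ s 0] ∈ (Ω : Set Plane) ∧
    γ s + p • !₂[deriv γ s 1, -deriv γ s 0] ∉ closure (Ω : Set Plane)

/-- The exterior domain `Ω₋ = ℝ² ∖ closure Ω`. -/
def exterior (Ω : TopologicalSpace.Opens Plane) : TopologicalSpace.Opens Plane :=
  ⟨(closure (Ω : Set Plane))ᶜ, isClosed_closure.isOpen_compl⟩

namespace Shell

variable {Ω : TopologicalSpace.Opens Plane} (Γ : Shell Ω)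

/-- The parametrization as a map into `Σ = ∂Ω`. -/
def point (s : ℝ) : frontier (Ω : Set Plane) := 
  ⟨Γ.γ s, (Set.ext_iff.1 Γ.range_eq _).1 (mem_range_self s)⟩

lemma exists_point (x : frontier (Ω : Set Plane)) : ∃ s, Γ.point s = x := by
  have hx : (x : Plane) ∈ range Γ.γ := (Set.ext_iff.1 Γ.range_eq _).2 x.2
  obtain ⟨s, hs⟩ := hx
  exact ⟨s, Subtype.ext hs⟩

/-- An arc-length parameter of a boundary point. -/
def param (x : frontier (Ω : Set Plane)) : ℝ := (Γ.exists_point x).choose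

lemma deriv_param_point (s : ℝ) : deriv Γ.γ (Γ.param (Γ.point s)) = deriv Γ.γ s := by
  have h : Γ.γ (Γ.param (Γ.point s)) = Γ.γ s :=
    congrArg Subtype.val (Γ.exists_point (Γ.point s)).choose_spec
  obtain ⟨k, hk⟩ := (Γ.eq_iff _ _).1 h
  have hper : (fun t => Γ.γ (t + k * Γ.len)) = Γ.γ := by
    funext t
    exact ((Γ.eq_iff t (t + k * Γ.len)).2 ⟨k, rfl⟩).symm
  conv_rhs => rw [hk, ← deriv_comp_add_const (f := Γ.γ), hper]

/-- `C^∞(Σ; 𝕜)`: functions on `Σ` that are smooth in the arc-length parameter. -/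
def Smooth (𝕜 : Type) [RCLike 𝕜] : Subalgebra 𝕜 (frontier (Ω : Set Plane) → 𝕜) where
  carrier := {φ | ContDiff ℝ ∞ (fun s => φ (Γ.point s))}
  mul_mem' := fun {a b} (ha : ContDiff ℝ ∞ fun s => a (Γ.point s))
    (hb : ContDiff ℝ ∞ fun s => b (Γ.point s)) => ContDiff.mul ha hb
  add_mem' := fun {a b} (ha : ContDiff ℝ ∞ fun s => a (Γ.point s))
    (hb : ContDiff ℝ ∞ fun s => b (Γ.point s)) => ContDiff.add ha hb
  algebraMap_mem' := fun c => (contDiff_const : ContDiff ℝ ∞ fun _ : ℝ => c)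

lemma Smooth.contDiff {𝕜 : Type} [RCLike 𝕜] (φ : Γ.Smooth 𝕜) :
    ContDiff ℝ ∞ (fun s => φ.1 (Γ.point s)) := φ.2

/-- A real-valued smooth function on `Σ`, regarded as complex-valued. -/
def toComplex (φ : Γ.Smooth ℝ) : Γ.Smooth ℂ :=
  ⟨fun x => (φ.1 x : ℂ), Complex.ofRealCLM.contDiff.comp (Smooth.contDiff Γ φ)⟩

/-- The components `n₁` (`j = 0`) and `n₂` (`j = 1`) of the outer unit normal
`n = (γ₂', -γ₁') ∘ γ⁻¹`. -/
def normal (j : Fin 2) : Γ.Smooth ℝ :=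
  ⟨fun x => (!₂[deriv Γ.γ (Γ.param x) 1, -deriv Γ.γ (Γ.param x) 0] : Plane) j, by
    have h : ContDiff ℝ ∞ (deriv Γ.γ) := (contDiff_infty_iff_deriv.1 Γ.contDiff).2
    have hc (i : Fin 2) : ContDiff ℝ ∞ (fun s => deriv Γ.γ s i) := by fun_prop
    change ContDiff ℝ ∞ _
    simp only [deriv_param_point]
    fin_cases j
    · simpa using hc 1
    · simpa using (hc 0).neg⟩

/-- The components of the unit tangent `t = (-n₂, n₁)`. -/
def tangent : Fin 2 → Γ.Smooth ℝ := ![-Γ.normal 1, Γ.normal 0]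

/-- A constant matrix as a matrix-valued function on `Σ`. -/
def const (A : Matrix (Fin 2) (Fin 2) ℂ) : Matrix (Fin 2) (Fin 2) (Γ.Smooth ℂ) :=
  A.map (algebraMap ℂ (Γ.Smooth ℂ))

/-- The matrix-valued function `σ · a = a₁ σ₁ + a₂ σ₂` on `Σ`, for a vector field `a` on `Σ`. -/
def sigmaDot (a : Fin 2 → Γ.Smooth ℝ) : Matrix (Fin 2) (Fin 2) (Γ.Smooth ℂ) :=
  Γ.toComplex (a 0) • Γ.const pauli₁ + Γ.toComplex (a 1) • Γ.const pauli₂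

/-! ### Generalized functions on the shell, and `H^{-1/2}(Σ)` -/

/-- Linear functionals on `C^∞(Σ; ℂ)`. -/
abbrev Functional := Module.Dual ℂ (Γ.Smooth ℂ)

/-- The product of a functional with a smooth function, `⟨a u, φ⟩ = ⟨u, a φ⟩`. -/
def mulFunctional (a : Γ.Smooth ℂ) (u : Γ.Functional) : Γ.Functional :=
  u ∘ₗ LinearMap.mulLeft ℂ a

/-- The product of a matrix-valued smooth function with a pair of functionals. -/
def matMul (A : Matrix (Fin 2) (Fin 2) (Γ.Smooth ℂ)) (u : Fin 2 → Γ.Functional) :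
    Fin 2 → Γ.Functional :=
  fun i => ∑ j, Γ.mulFunctional (A i j) (u j)

lemma continuous_smooth (φ : Γ.Smooth ℂ) : Continuous (fun s => φ.1 (Γ.point s)) :=
  (Smooth.contDiff Γ φ).continuous

/-- A smooth function on `Σ` as a functional, `φ ↦ ∫_Σ g φ ds` with the arc-length `ds`. -/
def toFunctional (g : Γ.Smooth ℂ) : Γ.Functional where
  toFun φ := ∫ s in (0 : ℝ)..Γ.len, g.1 (Γ.point s) * φ.1 (Γ.point s)
  map_add' φ ψ := by
    rw [← intervalIntegral.integral_add]
    · simp [mul_add]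
    · exact ((Γ.continuous_smooth g).mul (Γ.continuous_smooth φ)).intervalIntegrable _ _
    · exact ((Γ.continuous_smooth g).mul (Γ.continuous_smooth ψ)).intervalIntegrable _ _
  map_smul' c φ := by
    simp [mul_left_comm]

/-- The norm of `H^{1/2}(Σ)` on smooth functions, `(∑ₙ (1 + |n|) |φ̂(n)|²)^{1/2}`, where `φ̂(n)` are
the Fourier coefficients in the arc-length parameter. -/
def halfNorm (φ : Γ.Smooth ℂ) : ℝ≥0∞ :=
  (∑' n : ℤ, ENNReal.ofReal ((1 + |(n : ℝ)|) *
    ‖fourierCoeffOn Γ.len_pos (fun s => φ.1 (Γ.point s)) n‖ ^ 2)) ^ (1 / 2 : ℝ)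

/-- The norm of `H^{-1/2}(Σ)`, dual to that of `H^{1/2}(Σ)`. -/
def negHalfNorm (u : Γ.Functional) : ℝ≥0∞ := ⨆ φ : Γ.Smooth ℂ, ‖u φ‖ₑ / Γ.halfNorm φ

/-- Membership of a functional in `H^{-1/2}(Σ) = (H^{1/2}(Σ))'`. -/
def MemNegHalf (u : Γ.Functional) : Prop := Γ.negHalfNorm u < ⊤

/-! ### Dirichlet traces -/

/-- The restriction to `Σ` of the `j`-th component of a smooth function on the plane. -/
def restrict (F : 𝓓((⊤ : TopologicalSpace.Opens Plane), Spinor)) (j : Fin 2) : Γ.Smooth ℂ :=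
  ⟨fun x => F x j, by
    have h : ContDiff ℝ ∞ (fun s => F (Γ.γ s)) := F.contDiff.comp Γ.contDiff
    exact (((EuclideanSpace.proj (𝕜 := ℂ) j).restrictScalars ℝ).contDiff.comp h :)⟩

/-- `T ∈ H^{-1/2}(Σ; ℂ²)` is the Dirichlet trace of `f ∈ H(σ, U)`, where `U` is `Ω` or its
exterior. The trace is the extension by continuity, from `H(σ, U)` (with its graph norm) to
`H^{-1/2}(Σ; ℂ²)`, of the restriction of functions that are smooth up to the boundary: there are
smooth compactly supported functions on the plane whose restrictions to `U` converge to `f` in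
`H(σ, U)` and whose restrictions to `Σ` converge to `T` in `H^{-1/2}(Σ; ℂ²)`. -/
def IsTrace {U : TopologicalSpace.Opens Plane} (f : HSigma U) (T : Fin 2 → Γ.Functional) : Prop :=
  (∀ j, Γ.MemNegHalf (T j)) ∧
  ∃ (F : ℕ → 𝓓((⊤ : TopologicalSpace.Opens Plane), Spinor)) (h : ℕ → HSigma U),
    (∀ k, ((h k : L2 U) : Plane → Spinor) =ᵐ[volume.restrict (U : Set Plane)] F k) ∧
    Tendsto (fun k => (h k : L2 U)) atTop (𝓝 (f : L2 U)) ∧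
    Tendsto (fun k => sigmaGrad U (h k)) atTop (𝓝 (sigmaGrad U f)) ∧
    ∀ j, Tendsto (fun k => Γ.negHalfNorm (Γ.toFunctional (Γ.restrict (F k) j) - T j)) atTop (𝓝 0)

lemma negHalfNorm_zero : Γ.negHalfNorm 0 = 0 := by
  simp [negHalfNorm]

lemma negHalfNorm_add_le (u v : Γ.Functional) :
    Γ.negHalfNorm (u + v) ≤ Γ.negHalfNorm u + Γ.negHalfNorm v := by
  refine iSup_le fun φ => ?_
  calc ‖(u + v) φ‖ₑ / Γ.halfNorm φ ≤ (‖u φ‖ₑ + ‖v φ‖ₑ) / Γ.halfNorm φ := by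
        gcongr
        exact enorm_add_le _ _
    _ = ‖u φ‖ₑ / Γ.halfNorm φ + ‖v φ‖ₑ / Γ.halfNorm φ := ENNReal.add_div
    _ ≤ _ := add_le_add (le_iSup (fun φ => ‖u φ‖ₑ / Γ.halfNorm φ) φ)
        (le_iSup (fun φ => ‖v φ‖ₑ / Γ.halfNorm φ) φ)

lemma negHalfNorm_smul (c : ℂ) (u : Γ.Functional) :
    Γ.negHalfNorm (c • u) = ‖c‖ₑ * Γ.negHalfNorm u := by
  simp only [negHalfNorm, ENNReal.mul_iSup, LinearMap.smul_apply, enorm_smul, mul_div_assoc]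

lemma toFunctional_restrict_add (F G : 𝓓((⊤ : TopologicalSpace.Opens Plane), Spinor))
    (j : Fin 2) : Γ.toFunctional (Γ.restrict (F + G) j) =
      Γ.toFunctional (Γ.restrict F j) + Γ.toFunctional (Γ.restrict G j) := by
  ext φ
  change ∫ s in (0 : ℝ)..Γ.len, ((F + G) (Γ.γ s)) j * φ.1 (Γ.point s) =
    (∫ s in (0 : ℝ)..Γ.len, (Γ.restrict F j).1 (Γ.point s) * φ.1 (Γ.point s)) +
    ∫ s in (0 : ℝ)..Γ.len, (Γ.restrict G j).1 (Γ.point s) * φ.1 (Γ.point s)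
  rw [← intervalIntegral.integral_add]
  · apply intervalIntegral.integral_congr
    intro s _
    change (F (Γ.γ s) j + G (Γ.γ s) j) * φ.1 (Γ.point s) =
      F (Γ.γ s) j * φ.1 (Γ.point s) + G (Γ.γ s) j * φ.1 (Γ.point s)
    ring
  · exact ((Γ.continuous_smooth _).mul (Γ.continuous_smooth φ)).intervalIntegrable _ _
  · exact ((Γ.continuous_smooth _).mul (Γ.continuous_smooth φ)).intervalIntegrable _ _

lemma toFunctional_restrict_smul (c : ℂ) (F : 𝓓((⊤ : TopologicalSpace.Opens Plane), Spinor))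
    (j : Fin 2) : Γ.toFunctional (Γ.restrict (c • F) j) =
      c • Γ.toFunctional (Γ.restrict F j) := by
  ext φ
  change ∫ s in (0 : ℝ)..Γ.len, ((c • F) (Γ.γ s)) j * φ.1 (Γ.point s) =
    c • ∫ s in (0 : ℝ)..Γ.len, (Γ.restrict F j).1 (Γ.point s) * φ.1 (Γ.point s)
  rw [← intervalIntegral.integral_smul]
  apply intervalIntegral.integral_congr
  intro s _
  change (c • F (Γ.γ s) j) * φ.1 (Γ.point s) = c • (F (Γ.γ s) j * φ.1 (Γ.point s))
  simp [mul_assoc]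

variable {U : TopologicalSpace.Opens Plane}

lemma isTrace_zero : Γ.IsTrace (0 : HSigma U) 0 := by
  refine ⟨fun j => ?_, fun _ => 0, fun _ => 0, fun _ => ?_, tendsto_const_nhds,
    tendsto_const_nhds, fun j => ?_⟩
  · simp [MemNegHalf, negHalfNorm_zero]
  · exact Lp.coeFn_zero _ _ _
  · have h : Γ.toFunctional (Γ.restrict 0 j) = 0 := by
      simpa using Γ.toFunctional_restrict_smul 0 0 j
    simp [h, negHalfNorm_zero]

lemma IsTrace.add {f g : HSigma U} {S T : Fin 2 → Γ.Functional} (hf : Γ.IsTrace f S)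
    (hg : Γ.IsTrace g T) : Γ.IsTrace (f + g) (S + T) := by
  obtain ⟨hS, F, h, hF, h1, h2, h3⟩ := hf
  obtain ⟨hT, G, k, hG, k1, k2, k3⟩ := hg
  refine ⟨fun j => (Γ.negHalfNorm_add_le _ _).trans_lt (ENNReal.add_lt_top.2 ⟨hS j, hT j⟩),
    fun n => F n + G n, fun n => h n + k n, fun n => ?_, h1.add k1, ?_, fun j => ?_⟩
  · refine (Lp.coeFn_add _ _).trans ?_
    filter_upwards [hF n, hG n] with x hx hy
    rw [Pi.add_apply, hx, hy]
    rfl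
  · simp only [map_add]
    exact h2.add k2
  · have hs := (h3 j).add (k3 j)
    rw [add_zero] at hs
    refine tendsto_of_tendsto_of_tendsto_of_le_of_le tendsto_const_nhds hs
      (fun _ => bot_le) fun n => ?_
    simp only [toFunctional_restrict_add, Pi.add_apply]
    rw [add_sub_add_comm]
    exact Γ.negHalfNorm_add_le _ _

lemma IsTrace.smul (c : ℂ) {f : HSigma U} {T : Fin 2 → Γ.Functional} (hf : Γ.IsTrace f T) :
    Γ.IsTrace (c • f) (c • T) := by
  obtain ⟨hT, F, h, hF, h1, h2, h3⟩ := hf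
  refine ⟨fun j => ?_, fun n => c • F n, fun n => c • h n, fun n => ?_, h1.const_smul c, ?_,
    fun j => ?_⟩
  · change Γ.negHalfNorm (c • T j) < ⊤
    rw [negHalfNorm_smul]
    exact ENNReal.mul_lt_top enorm_lt_top (hT j)
  · refine (Lp.coeFn_smul _ _).trans ?_
    filter_upwards [hF n] with x hx
    rw [Pi.smul_apply, hx]
    rfl
  · simp only [map_smul]
    exact h2.const_smul c
  · have hs := ENNReal.Tendsto.const_mul (a := ‖c‖ₑ) (h3 j) (Or.inr enorm_ne_top)
    rw [mul_zero] at hs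
    simp only [toFunctional_restrict_smul, Pi.smul_apply, ← smul_sub, negHalfNorm_smul]
    exact hs

lemma matMul_add (A : Matrix (Fin 2) (Fin 2) (Γ.Smooth ℂ)) (S T : Fin 2 → Γ.Functional) :
    Γ.matMul A (S + T) = Γ.matMul A S + Γ.matMul A T := by
  funext i
  simp [matMul, mulFunctional, LinearMap.add_comp, add_add_add_comm]

lemma matMul_smul (A : Matrix (Fin 2) (Fin 2) (Γ.Smooth ℂ)) (c : ℂ) (T : Fin 2 → Γ.Functional) :
    Γ.matMul A (c • T) = c • Γ.matMul A T := by
  funext i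
  simp [matMul, mulFunctional, LinearMap.smul_comp]

lemma matMul_zero (A : Matrix (Fin 2) (Fin 2) (Γ.Smooth ℂ)) : Γ.matMul A 0 = 0 := by
  simpa using Γ.matMul_smul A 0 0

/-- The functions `f ∈ H(σ, U)`, where `U` is `Ω` or its exterior, whose Dirichlet trace `T`
satisfies the boundary condition `A T = 0`. -/
def bcDomain (U : TopologicalSpace.Opens Plane) (A : Matrix (Fin 2) (Fin 2) (Γ.Smooth ℂ)) :
    Submodule ℂ (L2 U) where
  carrier := {f | ∃ hf : f ∈ HSigma U, ∃ T, Γ.IsTrace ⟨f, hf⟩ T ∧ Γ.matMul A T = 0}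
  add_mem' := fun ⟨hf, S, hS, hA⟩ ⟨hg, T, hT, hB⟩ =>
    ⟨(HSigma U).add_mem hf hg, S + T, IsTrace.add Γ hS hT, by
      rw [matMul_add, hA, hB, add_zero]⟩
  zero_mem' := ⟨(HSigma U).zero_mem, 0, Γ.isTrace_zero, Γ.matMul_zero A⟩
  smul_mem' := fun c _ ⟨hf, T, hT, hA⟩ =>
    ⟨(HSigma U).smul_mem c hf, c • T, IsTrace.smul Γ c hT, by
      rw [matMul_smul, hA, smul_zero]⟩

lemma bcDomain_le (A : Matrix (Fin 2) (Fin 2) (Γ.Smooth ℂ)) : Γ.bcDomain U A ≤ HSigma U :=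
  fun _ ⟨hf, _⟩ => hf

/-- The operator `f ↦ D₀ f` in `L²(U; ℂ²)` with the boundary condition `A T = 0`. -/
def diracBC (m : ℝ) (U : TopologicalSpace.Opens Plane)
    (A : Matrix (Fin 2) (Fin 2) (Γ.Smooth ℂ)) : L2 U →ₗ.[ℂ] L2 U where
  domain := Γ.bcDomain U A
  toFun := diracExpr m U ∘ₗ Submodule.inclusion (Γ.bcDomain_le A)

/-! ### The decomposition `L²(ℝ²; ℂ²) = L²(Ω₊; ℂ²) ⊕ L²(Ω₋; ℂ²)` -/

/-- The curve has zero area. -/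
lemma volume_frontier (Γ : Shell Ω) : volume (frontier (Ω : Set Plane)) = 0 := by
  have hd : dimH (range Γ.γ) ≤ Module.finrank ℝ ℝ :=
    (Γ.contDiff.of_le (by simp)).dimH_range_le
  rw [← Γ.range_eq]
  have hm : (volume : Measure Plane) ≪ Measure.hausdorffMeasure ((2 : NNReal) : ℝ) := by
    have : (Measure.hausdorffMeasure (Module.finrank ℝ Plane : ℝ) :
      Measure Plane).IsAddHaarMeasure := isAddHaarMeasure_hausdorffMeasure
    have e : (Module.finrank ℝ Plane : ℝ) = ((2 : NNReal) : ℝ) := by simp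
    rw [← e]
    exact Measure.absolutelyContinuous_isAddHaarMeasure _ _
  refine measure_zero_of_dimH_lt hm (hd.trans_lt ?_)
  simp

/-- The restriction `f ↦ f↾U`. -/
def restrictTo (U : TopologicalSpace.Opens Plane) :
    Lp Spinor 2 (volume : Measure Plane) →ₗ[ℂ] L2 U :=
  (LpToLpRestrictCLM Plane Spinor ℂ volume 2 (U : Set Plane)).toLinearMap

/-- `f ↦ (f↾Ω₊, f↾Ω₋)`. -/
def restrictBoth (Ω : TopologicalSpace.Opens Plane) :
    Lp Spinor 2 (volume : Measure Plane) →ₗ[ℂ] WithLp 2 (L2 Ω × L2 (exterior Ω)) :=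
  (WithLp.linearEquiv 2 ℂ (L2 Ω × L2 (exterior Ω))).symm.toLinearMap ∘ₗ
    (restrictTo Ω).prod (restrictTo (exterior Ω))

lemma ae_mem (Γ : Shell Ω) :
    ∀ᵐ x : Plane, x ∈ (Ω : Set Plane) ∨ x ∈ (exterior Ω : Set Plane) := by
  have h := measure_eq_zero_iff_ae_notMem.1 Γ.volume_frontier
  filter_upwards [h] with x hx
  by_cases hc : x ∈ closure (Ω : Set Plane)
  · left
    by_contra hn
    exact hx ⟨hc, by rwa [Ω.isOpen.interior_eq]⟩
  · exact Or.inr hc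

lemma disjoint_exterior (Ω : TopologicalSpace.Opens Plane) :
    Disjoint (Ω : Set Plane) (exterior Ω : Set Plane) :=
  Set.disjoint_left.2 fun _ hx hy => hy (subset_closure hx)

lemma restrict_add (Γ : Shell Ω) :
    (volume.restrict (Ω : Set Plane) + volume.restrict (exterior Ω : Set Plane)) =
      (volume : Measure Plane) := by
  rw [← Measure.restrict_union (disjoint_exterior Ω) (exterior Ω).isOpen.measurableSet]
  exact Measure.restrict_eq_self_of_ae_mem Γ.ae_mem

lemma norm_sq_eq {μ : Measure Plane} (f : Lp Spinor 2 μ) :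
    ‖f‖ ^ 2 = ∫ x, ‖f x‖ ^ 2 ∂μ := by
  rw [← @inner_self_eq_norm_sq ℂ, L2.inner_def, ← integral_re (L2.integrable_inner f f)]
  simp only [inner_self_eq_norm_sq]

lemma norm_restrictBoth (Γ : Shell Ω) (f : Lp Spinor 2 (volume : Measure Plane)) :
    ‖restrictBoth Ω f‖ = ‖f‖ := by
  have hi : Integrable (fun x => ‖f x‖ ^ 2) (volume : Measure Plane) :=
    (memLp_two_iff_integrable_sq_norm (Lp.memLp f).1).1 (Lp.memLp f)
  have e (s : Set Plane) : ‖LpToLpRestrictCLM Plane Spinor ℂ volume 2 s f‖ ^ 2 =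
      ∫ x in s, ‖f x‖ ^ 2 := by
    rw [norm_sq_eq]
    apply integral_congr_ae
    filter_upwards [LpToLpRestrictCLM_coeFn ℂ s f] with x hx
    rw [hx]
  rw [← sq_eq_sq₀ (norm_nonneg _) (norm_nonneg _), WithLp.prod_norm_sq_eq_of_L2]
  change ‖LpToLpRestrictCLM Plane Spinor ℂ volume 2 (Ω : Set Plane) f‖ ^ 2 +
    ‖LpToLpRestrictCLM Plane Spinor ℂ volume 2 (exterior Ω : Set Plane) f‖ ^ 2 = _
  rw [e, e, norm_sq_eq, ← integral_add_measure hi.restrict hi.restrict, Γ.restrict_add]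

lemma surjective_restrictBoth (Ω : TopologicalSpace.Opens Plane) :
    Function.Surjective (restrictBoth Ω) := by
  intro p
  have h1 : MemLp ((Ω : Set Plane).indicator (p.fst : Plane → Spinor)) 2 volume :=
    (memLp_indicator_iff_restrict Ω.isOpen.measurableSet).2 (Lp.memLp p.fst)
  have h2 : MemLp ((exterior Ω : Set Plane).indicator (p.snd : Plane → Spinor)) 2 volume :=
    (memLp_indicator_iff_restrict (exterior Ω).isOpen.measurableSet).2 (Lp.memLp p.snd)
  refine ⟨(h1.add h2).toLp _, ?_⟩
  have hd := Set.disjoint_left.1 (disjoint_exterior Ω)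
  apply (WithLp.ofLp_injective 2)
  apply Prod.ext
  · apply Lp.ext
    refine (LpToLpRestrictCLM_coeFn ℂ (Ω : Set Plane) _).trans ?_
    filter_upwards [ae_restrict_of_ae (h1.add h2).coeFn_toLp,
      ae_restrict_mem Ω.isOpen.measurableSet] with x hx hxm
    rw [hx, Pi.add_apply, indicator_of_mem hxm, indicator_of_notMem (hd hxm), add_zero]
    rfl
  · apply Lp.ext
    refine (LpToLpRestrictCLM_coeFn ℂ (exterior Ω : Set Plane) _).trans ?_
    filter_upwards [ae_restrict_of_ae (h1.add h2).coeFn_toLp,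
      ae_restrict_mem (exterior Ω).isOpen.measurableSet] with x hx hxm
    rw [hx, Pi.add_apply, indicator_of_mem hxm, indicator_of_notMem (fun h => hd h hxm), zero_add]
    rfl

/-- The identification `L²(ℝ²; ℂ²) = L²(Ω₊; ℂ²) ⊕ L²(Ω₋; ℂ²)`, `f ↦ (f↾Ω₊, f↾Ω₋)`, an
isometric isomorphism onto the orthogonal (Hilbert) sum. -/
def split (Γ : Shell Ω) :
    Lp Spinor 2 (volume : Measure Plane) ≃ₗᵢ[ℂ] WithLp 2 (L2 Ω × L2 (exterior Ω)) :=
  LinearIsometryEquiv.ofSurjective ⟨restrictBoth Ω, Γ.norm_restrictBoth⟩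
    (surjective_restrictBoth Ω)

/-- The element `g₊ ⊕ g₋` of `L²(ℝ²; ℂ²)`. -/
def glue (Γ : Shell Ω) : L2 Ω × L2 (exterior Ω) →ₗ[ℂ] Lp Spinor 2 (volume : Measure Plane) :=
  Γ.split.symm.toLinearEquiv.toLinearMap ∘ₗ
    (WithLp.linearEquiv 2 ℂ (L2 Ω × L2 (exterior Ω))).symm.toLinearMap

/-- The orthogonal sum `A ⊕ B`, as an operator in `L²(ℝ²; ℂ²) = L²(Ω₊; ℂ²) ⊕ L²(Ω₋; ℂ²)`, of
operators `A` in `L²(Ω₊; ℂ²)` and `B` in `L²(Ω₋; ℂ²)`. -/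
def orthogonalSum (A : L2 Ω →ₗ.[ℂ] L2 Ω) (B : L2 (exterior Ω) →ₗ.[ℂ] L2 (exterior Ω)) :
    Lp Spinor 2 (volume : Measure Plane) →ₗ.[ℂ] Lp Spinor 2 (volume : Measure Plane) where
  domain := A.domain.comap (restrictTo Ω) ⊓ B.domain.comap (restrictTo (exterior Ω))
  toFun := Γ.glue ∘ₗ
    (A.toFun ∘ₗ (restrictTo Ω).restrict fun _ hf => (Submodule.mem_inf.1 hf).1).prod
      (B.toFun ∘ₗ (restrictTo (exterior Ω)).restrict fun _ hf => (Submodule.mem_inf.1 hf).2)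

/-! ### The Dirac operator with a shell interaction, and the confined operators -/

/-- `η I₂ + τ σ₃ + λ (σ · t)`. -/
def interaction (η τ lam : Γ.Smooth ℝ) : Matrix (Fin 2) (Fin 2) (Γ.Smooth ℂ) :=
  Γ.toComplex η • 1 + Γ.toComplex τ • Γ.const pauli₃ + Γ.toComplex lam • Γ.sigmaDot Γ.tangent

/-- The domain of the Dirac operator with shell interaction: all `f = f₊ ⊕ f₋` in
`H(σ, Ω₊) ⊕ H(σ, Ω₋)` whose Dirichlet traces `T₊`, `T₋` satisfy the transmission condition
`i (σ · n) (T₋ - T₊) = ½ (η I₂ + τ σ₃ + λ (σ · t)) (T₋ + T₊)`. -/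
def shellDomain (η τ lam : Γ.Smooth ℝ) : Submodule ℂ (Lp Spinor 2 (volume : Measure Plane)) where
  carrier := {f | ∃ (hp : restrictTo Ω f ∈ HSigma Ω)
    (hm : restrictTo (exterior Ω) f ∈ HSigma (exterior Ω)) (Tp Tm : Fin 2 → Γ.Functional),
    Γ.IsTrace ⟨_, hp⟩ Tp ∧ Γ.IsTrace ⟨_, hm⟩ Tm ∧
    Γ.matMul (Complex.I • Γ.sigmaDot Γ.normal) (Tm - Tp) =
      Γ.matMul ((1 / 2 : ℂ) • Γ.interaction η τ lam) (Tm + Tp)}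
  add_mem' := by
    rintro f g ⟨hp, hm, Tp, Tm, h1, h2, h3⟩ ⟨kp, km, Sp, Sm, k1, k2, k3⟩
    refine ⟨by rw [map_add]; exact add_mem hp kp, by rw [map_add]; exact add_mem hm km,
      Tp + Sp, Tm + Sm, ?_, ?_, ?_⟩
    · simp only [map_add]
      exact IsTrace.add Γ h1 k1
    · simp only [map_add]
      exact IsTrace.add Γ h2 k2
    · rw [add_sub_add_comm, matMul_add, h3, k3, ← matMul_add, add_add_add_comm]
  zero_mem' := by
    refine ⟨by rw [map_zero]; exact zero_mem _, by rw [map_zero]; exact zero_mem _, 0, 0,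
      ?_, ?_, ?_⟩
    · simp only [map_zero]
      exact Γ.isTrace_zero
    · simp only [map_zero]
      exact Γ.isTrace_zero
    · rw [sub_zero, add_zero, matMul_zero, matMul_zero]
  smul_mem' := by
    rintro c f ⟨hp, hm, Tp, Tm, h1, h2, h3⟩
    refine ⟨by rw [map_smul]; exact Submodule.smul_mem _ c hp,
      by rw [map_smul]; exact Submodule.smul_mem _ c hm, c • Tp, c • Tm, ?_, ?_, ?_⟩
    · simp only [map_smul]
      exact IsTrace.smul Γ c h1
    · simp only [map_smul]
      exact IsTrace.smul Γ c h2
    · rw [← smul_sub, matMul_smul, h3, ← matMul_smul, smul_add]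

lemma shellDomain_int {η τ lam : Γ.Smooth ℝ} :
    ∀ f ∈ Γ.shellDomain η τ lam, restrictTo Ω f ∈ HSigma Ω :=
  fun _ ⟨hp, _⟩ => hp

lemma shellDomain_ext {η τ lam : Γ.Smooth ℝ} :
    ∀ f ∈ Γ.shellDomain η τ lam, restrictTo (exterior Ω) f ∈ HSigma (exterior Ω) :=
  fun _ ⟨_, hm, _⟩ => hm

/-- The Dirac operator with shell interaction, `f₊ ⊕ f₋ ↦ D₀ f₊ ⊕ D₀ f₋`. -/
def shellDirac (m : ℝ) (η τ lam : Γ.Smooth ℝ) :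
    Lp Spinor 2 (volume : Measure Plane) →ₗ.[ℂ] Lp Spinor 2 (volume : Measure Plane) where
  domain := Γ.shellDomain η τ lam
  toFun := Γ.glue ∘ₗ
    (diracExpr m Ω ∘ₗ (restrictTo Ω).restrict Γ.shellDomain_int).prod
      (diracExpr m (exterior Ω) ∘ₗ (restrictTo (exterior Ω)).restrict Γ.shellDomain_ext)

/-- The operator in `L²(Ω₊; ℂ²)` with boundary condition
`[i (σ · n) + ½ (η I₂ + τ σ₃ + λ (σ · t))] T₊ = 0`. -/
def interiorDirac (m : ℝ) (η τ lam : Γ.Smooth ℝ) : L2 Ω →ₗ.[ℂ] L2 Ω :=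
  Γ.diracBC m Ω (Complex.I • Γ.sigmaDot Γ.normal + (1 / 2 : ℂ) • Γ.interaction η τ lam)

/-- The operator in `L²(Ω₋; ℂ²)` with boundary condition
`[-i (σ · n) + ½ (η I₂ + τ σ₃ + λ (σ · t))] T₋ = 0`. -/
def exteriorDirac (m : ℝ) (η τ lam : Γ.Smooth ℝ) : L2 (exterior Ω) →ₗ.[ℂ] L2 (exterior Ω) :=
  Γ.diracBC m (exterior Ω)
    (-(Complex.I • Γ.sigmaDot Γ.normal) + (1 / 2 : ℂ) • Γ.interaction η τ lam)

/-- `cos θ` for a smooth function `θ` on `Σ`. -/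
def cos (θ : Γ.Smooth ℝ) : Γ.Smooth ℝ :=
  ⟨fun x => Real.cos (θ.1 x), Real.contDiff_cos.comp (Smooth.contDiff Γ θ)⟩

/-- `sin θ` for a smooth function `θ` on `Σ`. -/
def sin (θ : Γ.Smooth ℝ) : Γ.Smooth ℝ :=
  ⟨fun x => Real.sin (θ.1 x), Real.contDiff_sin.comp (Smooth.contDiff Γ θ)⟩

/-- The Dirac operator in `L²(Ω₊; ℂ²)` with the quantum-dot boundary condition
`[I₂ - cos θ (σ · t) - sin θ σ₃] T₊ = 0`. -/
def quantumDot (m : ℝ) (θ : Γ.Smooth ℝ) : L2 Ω →ₗ.[ℂ] L2 Ω :=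
  Γ.diracBC m Ω (1 - Γ.toComplex (Γ.cos θ) • Γ.sigmaDot Γ.tangent -
    Γ.toComplex (Γ.sin θ) • Γ.const pauli₃)

end Shell
end DeltaShell
end

/-!
The transmission condition and the boundary conditions are linear systems for pairs of functionals
on `Σ`, with coefficients in `2 × 2` matrices over the commutative ring `C^∞(Σ; ℂ)`, so the theorem
is a matter of matrix identities over that ring. They follow from `n₁² + n₂² = 1`, which makes
`σ · n`, `σ · t` and `σ₃` pairwise anticommuting involutions.

Put `B = i (σ · n)` and `A = ½ (η + τ σ₃ + λ (σ · t))`. The transmission condition reads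
`(A + B) T₊ = -(A - B) T₋`. If `η² - τ² - λ² = -4`, then the adjugates `η - A ∓ B` of `A ± B`
satisfy `(η - A - B) (A + B) = 0` and `(η - A + B) (A - B) = 0` (`adjugate_mul_eq_zero`). The common
value `w = (A + B) T₊` is therefore annihilated by both adjugates, hence by their difference `2 B`,
which is invertible; so `w = 0`, and the condition decouples (`transmission_iff`).

The quantum-dot matrix is `B⁻¹ (A + B)` for `(η, τ, λ) = (0, 2 cos θ, -2 sin θ)`
(`sigmaDot_normal_mul_quantumDot`), so both matrices annihilate the same traces. For
`(η, τ, λ) = (0, 0, ±2)` the matrix `A + B` has a single nonzero entry, which is a unit because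
`(n₁ + i n₂) (n₁ - i n₂) = 1`.

These equivalences hold for arbitrary functionals, in particular for any choice of traces, so the
domains of the operators agree; the actions agree because all are given by the same differential
expression.
-/

noncomputable section

open scoped Matrix

namespace DeltaShell

/-! ### Matrix identities over a commutative ring -/

section Ring

variable {R : Type*} [CommRing R]

/-- `σ · a` for `a = (x, y)`, over a ring in which `i` plays the role of the imaginary unit.
The tangent `(-y, x)` to the normal `(x, y)` gives `pauliDot i (-y) x`. -/
def pauliDot (i x y : R) : Matrix (Fin 2) (Fin 2) R := !![0, x - i * y; x + i * y, 0]

lemma smul_add_smul_eq_pauliDot (i x y : R) :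
    x • (!![0, 1; 1, 0] : Matrix (Fin 2) (Fin 2) R) + y • !![0, -i; i, 0] = pauliDot i x y := by
  ext p q : 2
  fin_cases p <;> fin_cases q <;> simp [pauliDot] <;> ring

lemma smul_pauliDot_mul_self {i x y : R} (hi : i * i = -1) (hn : x * x + y * y = 1) :
    (i • pauliDot i x y) * (i • pauliDot i x y) = -1 := by
  ext p q : 2
  fin_cases p <;> fin_cases q <;> simp [pauliDot, Matrix.mul_apply]
  all_goals linear_combination (x * x - i * i * y * y + y * y) * hi - hn

/-- `(η - A - ε B) (A + ε B) = 0` for `ε² = 1`, with `B = i (σ · n)` and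
`A = ½ (η + τ σ₃ + λ (σ · t))`: the first factor is the adjugate of the second, whose determinant
`¼ (η² - τ² - λ²) + 1` vanishes. The ring element `h` is `½`. -/
lemma adjugate_mul_eq_zero {i x y h η τ l ε : R} (hi : i * i = -1) (hn : x * x + y * y = 1)
    (hh : 2 * h = 1) (hd : η ^ 2 - τ ^ 2 - l ^ 2 = -4) (hε : ε * ε = 1) :
    (η • 1 - h • (η • 1 + τ • !![1, 0; 0, -1] + l • pauliDot i (-y) x) -
        ε • (i • pauliDot i x y)) *
      (h • (η • 1 + τ • !![1, 0; 0, -1] + l • pauliDot i (-y) x) + ε • (i • pauliDot i x y)) =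
      0 := by
  -- The first factor contains `η` where the adjugate, computed entrywise, has `2 h η`.
  have hη : η = 2 * h * η := by rw [hh, one_mul]
  have hprod : (h * (l * (-y - i * x)) + ε * (i * (x - i * y))) *
      (h * (l * (-y + i * x)) + ε * (i * (x + i * y))) = h ^ 2 * l ^ 2 - 1 := by
    have e1 : i * (x - i * y) = i * x + y := by linear_combination (-y) * hi
    have e2 : i * (x + i * y) = i * x - y := by linear_combination y * hi
    rw [e1, e2]
    linear_combination (-(h ^ 2 * l ^ 2) + ε ^ 2) * x ^ 2 * hi + (h ^ 2 * l ^ 2 - ε ^ 2) * hn - hε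
  have hdet : h ^ 2 * (η ^ 2 - τ ^ 2) - (h * (l * (-y - i * x)) + ε * (i * (x - i * y))) *
      (h * (l * (-y + i * x)) + ε * (i * (x + i * y))) = 0 := by
    rw [hprod]
    linear_combination h ^ 2 * hd - (2 * h + 1) * hh
  ext p q : 2
  fin_cases p <;> fin_cases q <;> simp [pauliDot, Matrix.mul_apply]
  · linear_combination hdet + h * (η + τ) * hη
  · linear_combination (h * (l * (-y - i * x)) + ε * (i * (x - i * y))) * hη
  · linear_combination (h * (l * (-y + i * x)) + ε * (i * (x + i * y))) * hη
  · linear_combination hdet + h * (η - τ) * hη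

lemma adjugate_mul_eq_zero_neg {i x y h η τ l : R} (hi : i * i = -1) (hn : x * x + y * y = 1)
    (hh : 2 * h = 1) (hd : η ^ 2 - τ ^ 2 - l ^ 2 = -4) :
    (η • 1 - h • (η • 1 + τ • !![1, 0; 0, -1] + l • pauliDot i (-y) x) + i • pauliDot i x y) *
      (-(i • pauliDot i x y) + h • (η • 1 + τ • !![1, 0; 0, -1] + l • pauliDot i (-y) x)) = 0 := by
  have h1 := adjugate_mul_eq_zero (ε := -1) hi hn hh hd (by ring)
  rw [neg_one_smul, sub_neg_eq_add] at h1
  rw [neg_add_eq_sub, sub_eq_add_neg (h • _) (i • _)]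
  exact h1

lemma adjugate_mul_eq_zero_pos {i x y h η τ l : R} (hi : i * i = -1) (hn : x * x + y * y = 1)
    (hh : 2 * h = 1) (hd : η ^ 2 - τ ^ 2 - l ^ 2 = -4) :
    (η • 1 - h • (η • 1 + τ • !![1, 0; 0, -1] + l • pauliDot i (-y) x) - i • pauliDot i x y) *
      (i • pauliDot i x y + h • (η • 1 + τ • !![1, 0; 0, -1] + l • pauliDot i (-y) x)) = 0 := by
  have h1 := adjugate_mul_eq_zero (ε := 1) hi hn hh hd (one_mul 1)
  rw [one_smul, add_comm (h • _) (i • _)] at h1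
  exact h1

/-- `i (σ · n) (1 - c (σ · t) - s σ₃) = i (σ · n) + c σ₃ - s (σ · t)`. -/
lemma smul_pauliDot_mul_quantumDot {i x y h c s : R} (hi : i * i = -1)
    (hn : x * x + y * y = 1) (hh : 2 * h = 1) :
    (i • pauliDot i x y) * (1 - c • pauliDot i (-y) x - s • !![1, 0; 0, -1]) =
      i • pauliDot i x y + h • ((0 : R) • 1 + (2 * c) • !![1, 0; 0, -1] +
        (-2 * s) • pauliDot i (-y) x) := by
  ext p q : 2
  fin_cases p <;> fin_cases q <;> simp [pauliDot, Matrix.mul_apply]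
  · linear_combination (c * i * x * y - c * (x * x + y * y)) * hi + c * hn - c * hh
  · linear_combination (-s * y) * hi - s * (y + i * x) * hh
  · linear_combination (-s * y) * hi + s * (i * x - y) * hh
  · linear_combination (-(c * i * x * y) - c * (x * x + y * y)) * hi + c * hn - c * hh

/-- For `(η, τ, λ) = (0, 0, 2)` the interior boundary matrix involves the first component only. -/
lemma smul_pauliDot_add_two {i x y h : R} (hi : i * i = -1) (hh : 2 * h = 1) :
    i • pauliDot i x y + h • ((0 : R) • 1 + (0 : R) • !![1, 0; 0, -1] +
      (2 : R) • pauliDot i (-y) x) = !![0, 0; 2 * (i * x - y), 0] := by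
  ext p q : 2
  fin_cases p <;> fin_cases q <;> simp [pauliDot]
  · linear_combination (-y - i * x) * hh - y * hi
  · linear_combination (-y + i * x) * hh + y * hi

/-- For `(η, τ, λ) = (0, 0, -2)` the interior boundary matrix involves the second component
only. -/
lemma smul_pauliDot_add_neg_two {i x y h : R} (hi : i * i = -1) (hh : 2 * h = 1) :
    i • pauliDot i x y + h • ((0 : R) • 1 + (0 : R) • !![1, 0; 0, -1] +
      (-2 : R) • pauliDot i (-y) x) = !![0, 2 * (i * x + y); 0, 0] := by
  ext p q : 2
  fin_cases p <;> fin_cases q <;> simp [pauliDot]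
  · linear_combination (y + i * x) * hh - y * hi
  · linear_combination (y - i * x) * hh + y * hi

lemma isUnit_two_mul_sub {i x y h : R} (hi : i * i = -1) (hn : x * x + y * y = 1)
    (hh : 2 * h = 1) : IsUnit (2 * (i * x - y)) :=
  .of_mul_eq_one (h * (-(i * x) - y)) (by
    linear_combination (-(i * i * x * x) + y * y) * hh - x * x * hi + hn)

lemma isUnit_two_mul_add {i x y h : R} (hi : i * i = -1) (hn : x * x + y * y = 1)
    (hh : 2 * h = 1) : IsUnit (2 * (i * x + y)) :=
  .of_mul_eq_one (h * (-(i * x) + y)) (by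
    linear_combination (-(i * i * x * x) + y * y) * hh - x * x * hi + hn)

end Ring

namespace Shell

variable {Ω : TopologicalSpace.Opens Plane} (Γ : Shell Ω)

/-! ### Matrices of smooth functions acting on pairs of functionals -/

lemma mulFunctional_zero_left (u : Γ.Functional) : Γ.mulFunctional 0 u = 0 := by
  ext φ
  simp [mulFunctional]

lemma mulFunctional_one (u : Γ.Functional) : Γ.mulFunctional 1 u = u := by
  ext φ
  simp [mulFunctional]

lemma mulFunctional_zero_right (a : Γ.Smooth ℂ) : Γ.mulFunctional a 0 = 0 := by
  ext φ
  simp [mulFunctional]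

lemma mulFunctional_add_left (a b : Γ.Smooth ℂ) (u : Γ.Functional) :
    Γ.mulFunctional (a + b) u = Γ.mulFunctional a u + Γ.mulFunctional b u := by
  ext φ
  simp [mulFunctional, add_mul]

lemma mulFunctional_add_right (a : Γ.Smooth ℂ) (u v : Γ.Functional) :
    Γ.mulFunctional a (u + v) = Γ.mulFunctional a u + Γ.mulFunctional a v := by
  ext φ
  simp [mulFunctional]

lemma mulFunctional_mul (a b : Γ.Smooth ℂ) (u : Γ.Functional) :
    Γ.mulFunctional (a * b) u = Γ.mulFunctional a (Γ.mulFunctional b u) := by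
  ext φ
  simp [mulFunctional, mul_left_comm]

lemma mulFunctional_eq_zero_iff {a : Γ.Smooth ℂ} (ha : IsUnit a) (u : Γ.Functional) :
    Γ.mulFunctional a u = 0 ↔ u = 0 := by
  refine ⟨fun h => ?_, fun h => by rw [h, mulFunctional_zero_right]⟩
  obtain ⟨b, hb⟩ := ha.exists_left_inv
  rw [← Γ.mulFunctional_one u, ← hb, mulFunctional_mul, h, mulFunctional_zero_right]

lemma matMul_zero_left (T : Fin 2 → Γ.Functional) : Γ.matMul 0 T = 0 := by
  funext i
  simp [matMul, mulFunctional_zero_left]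

lemma matMul_one (T : Fin 2 → Γ.Functional) : Γ.matMul 1 T = T := by
  funext i
  rw [matMul, Finset.sum_eq_single i, Matrix.one_apply_eq, mulFunctional_one]
  · intro j _ hj
    rw [Matrix.one_apply_ne hj.symm, mulFunctional_zero_left]
  · simp

lemma matMul_add_left (A B : Matrix (Fin 2) (Fin 2) (Γ.Smooth ℂ)) (T : Fin 2 → Γ.Functional) :
    Γ.matMul (A + B) T = Γ.matMul A T + Γ.matMul B T := by
  funext i
  simp only [matMul, Matrix.add_apply, mulFunctional_add_left, Finset.sum_add_distrib,
    Pi.add_apply]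

lemma matMul_neg_left (A : Matrix (Fin 2) (Fin 2) (Γ.Smooth ℂ)) (T : Fin 2 → Γ.Functional) :
    Γ.matMul (-A) T = -Γ.matMul A T := by
  rw [eq_neg_iff_add_eq_zero, ← matMul_add_left, neg_add_cancel, matMul_zero_left]

lemma matMul_sub_left (A B : Matrix (Fin 2) (Fin 2) (Γ.Smooth ℂ)) (T : Fin 2 → Γ.Functional) :
    Γ.matMul (A - B) T = Γ.matMul A T - Γ.matMul B T := by
  rw [sub_eq_add_neg, matMul_add_left, matMul_neg_left, sub_eq_add_neg]

lemma matMul_neg (A : Matrix (Fin 2) (Fin 2) (Γ.Smooth ℂ)) (T : Fin 2 → Γ.Functional) :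
    Γ.matMul A (-T) = -Γ.matMul A T := by
  rw [← neg_one_smul ℂ T, matMul_smul, neg_one_smul]

lemma matMul_mul (A B : Matrix (Fin 2) (Fin 2) (Γ.Smooth ℂ)) (T : Fin 2 → Γ.Functional) :
    Γ.matMul (A * B) T = Γ.matMul A (Γ.matMul B T) := by
  funext i
  simp only [matMul, Matrix.mul_apply, Fin.sum_univ_two, mulFunctional_add_left,
    mulFunctional_add_right, mulFunctional_mul]
  abel

lemma matMul_eq_zero_of_mul {A B C : Matrix (Fin 2) (Fin 2) (Γ.Smooth ℂ)} (h : C * A = B)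
    {T : Fin 2 → Γ.Functional} (hT : Γ.matMul A T = 0) : Γ.matMul B T = 0 := by
  rw [← h, matMul_mul, hT, matMul_zero]

lemma matMul_lower_eq_zero_iff {a : Γ.Smooth ℂ} (ha : IsUnit a) (T : Fin 2 → Γ.Functional) :
    Γ.matMul !![0, 0; a, 0] T = 0 ↔ T 0 = 0 := by
  rw [funext_iff, Fin.forall_fin_two, ← Γ.mulFunctional_eq_zero_iff ha]
  simp [matMul, mulFunctional_zero_left]

lemma matMul_upper_eq_zero_iff {a : Γ.Smooth ℂ} (ha : IsUnit a) (T : Fin 2 → Γ.Functional) :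
    Γ.matMul !![0, a; 0, 0] T = 0 ↔ T 1 = 0 := by
  rw [funext_iff, Fin.forall_fin_two, ← Γ.mulFunctional_eq_zero_iff ha]
  simp [matMul, mulFunctional_zero_left]

/-! ### Matrix identities on the shell -/

/-- The imaginary unit as a constant function on `Σ`. -/
def imag : Γ.Smooth ℂ := algebraMap ℂ (Γ.Smooth ℂ) Complex.I

lemma imag_mul_self : Γ.imag * Γ.imag = -1 := by
  rw [imag, ← map_mul, Complex.I_mul_I, map_neg, map_one]

lemma toComplex_add (a b : Γ.Smooth ℝ) :
    Γ.toComplex (a + b) = Γ.toComplex a + Γ.toComplex b :=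
  Subtype.ext (funext fun x => Complex.ofReal_add (a.1 x) (b.1 x))

lemma toComplex_mul (a b : Γ.Smooth ℝ) :
    Γ.toComplex (a * b) = Γ.toComplex a * Γ.toComplex b :=
  Subtype.ext (funext fun x => Complex.ofReal_mul (a.1 x) (b.1 x))

lemma toComplex_one : Γ.toComplex 1 = 1 :=
  Subtype.ext (funext fun _ => Complex.ofReal_one)

lemma toComplex_zero : Γ.toComplex 0 = 0 :=
  Subtype.ext (funext fun _ => Complex.ofReal_zero)

lemma toComplex_neg (a : Γ.Smooth ℝ) : Γ.toComplex (-a) = -Γ.toComplex a :=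
  Subtype.ext (funext fun x => Complex.ofReal_neg (a.1 x))

lemma toComplex_two : Γ.toComplex 2 = 2 :=
  Subtype.ext (funext fun _ => Complex.ofReal_ofNat 2)

/-- The normal is a unit vector because the curve is parametrized by arc length. -/
lemma normal_sq : Γ.toComplex (Γ.normal 0) * Γ.toComplex (Γ.normal 0) +
    Γ.toComplex (Γ.normal 1) * Γ.toComplex (Γ.normal 1) = 1 := by
  rw [← toComplex_mul, ← toComplex_mul, ← toComplex_add, ← toComplex_one]
  congr 1
  refine Subtype.ext (funext fun x => ?_)
  have h := EuclideanSpace.real_norm_sq_eq (deriv Γ.γ (Γ.param x))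
  rw [Γ.norm_deriv, Fin.sum_univ_two] at h
  change deriv Γ.γ (Γ.param x) 1 * deriv Γ.γ (Γ.param x) 1 +
    -deriv Γ.γ (Γ.param x) 0 * -deriv Γ.γ (Γ.param x) 0 = 1
  linarith

lemma const_pauli₁ : Γ.const pauli₁ = !![0, 1; 1, 0] := by
  ext i j : 2
  fin_cases i <;> fin_cases j <;> simp [const, pauli₁]

lemma const_pauli₂ : Γ.const pauli₂ = !![0, -Γ.imag; Γ.imag, 0] := by
  ext i j : 2
  fin_cases i <;> fin_cases j <;> simp [const, pauli₂, imag]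

lemma const_pauli₃ : Γ.const pauli₃ = !![1, 0; 0, -1] := by
  ext i j : 2
  fin_cases i <;> fin_cases j <;> simp [const, pauli₃]

/-- The function `½` on `Σ`. -/
def half : Γ.Smooth ℂ := algebraMap ℂ (Γ.Smooth ℂ) (1 / 2)

lemma two_mul_half : 2 * Γ.half = 1 := by
  rw [half, ← map_ofNat (algebraMap ℂ (Γ.Smooth ℂ)) 2, ← map_mul]
  norm_num

lemma sigmaDot_eq (a : Fin 2 → Γ.Smooth ℝ) :
    Γ.sigmaDot a = pauliDot Γ.imag (Γ.toComplex (a 0)) (Γ.toComplex (a 1)) := by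
  rw [sigmaDot, const_pauli₁, const_pauli₂]
  exact smul_add_smul_eq_pauliDot _ _ _

lemma sigmaDot_tangent : Γ.sigmaDot Γ.tangent =
    pauliDot Γ.imag (-Γ.toComplex (Γ.normal 1)) (Γ.toComplex (Γ.normal 0)) := by
  rw [sigmaDot_eq, ← toComplex_neg]
  rfl

/-- Scalar multiplication by `Complex.I` is rewritten as multiplication by a constant function, so
that all coefficients lie in the ring `C^∞(Σ; ℂ)`. -/
lemma I_smul_sigmaDot_normal : Complex.I • Γ.sigmaDot Γ.normal =
    Γ.imag • pauliDot Γ.imag (Γ.toComplex (Γ.normal 0)) (Γ.toComplex (Γ.normal 1)) := by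
  rw [← sigmaDot_eq]
  exact (algebraMap_smul (Γ.Smooth ℂ) Complex.I (Γ.sigmaDot Γ.normal)).symm

lemma half_smul_interaction (η τ lam : Γ.Smooth ℝ) : (1 / 2 : ℂ) • Γ.interaction η τ lam =
    Γ.half • (Γ.toComplex η • 1 + Γ.toComplex τ • !![1, 0; 0, -1] +
      Γ.toComplex lam • pauliDot Γ.imag (-Γ.toComplex (Γ.normal 1)) (Γ.toComplex (Γ.normal 0))) := by
  rw [← sigmaDot_tangent, ← const_pauli₃]
  exact (algebraMap_smul (Γ.Smooth ℂ) (1 / 2 : ℂ) (Γ.interaction η τ lam)).symm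

lemma sigmaDot_normal_mul_self :
    (Complex.I • Γ.sigmaDot Γ.normal) * (Complex.I • Γ.sigmaDot Γ.normal) = -1 := by
  rw [I_smul_sigmaDot_normal]
  exact smul_pauliDot_mul_self Γ.imag_mul_self Γ.normal_sq

lemma matMul_normal_eq_zero {T : Fin 2 → Γ.Functional}
    (h : Γ.matMul (Complex.I • Γ.sigmaDot Γ.normal) T = 0) : T = 0 := by
  have h1 := Γ.matMul_eq_zero_of_mul Γ.sigmaDot_normal_mul_self h
  rwa [matMul_neg_left, matMul_one, neg_eq_zero] at h1

lemma toComplex_sq_sub_sq {η τ lam : Γ.Smooth ℝ}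
    (h : ∀ x, η.1 x ^ 2 - τ.1 x ^ 2 - lam.1 x ^ 2 = -4) :
    Γ.toComplex η ^ 2 - Γ.toComplex τ ^ 2 - Γ.toComplex lam ^ 2 = -4 := by
  refine Subtype.ext (funext fun x => ?_)
  change (η.1 x : ℂ) ^ 2 - (τ.1 x : ℂ) ^ 2 - (lam.1 x : ℂ) ^ 2 = -4
  exact_mod_cast h x

/-! ### Decoupling of the transmission condition -/

/-- For `η² - τ² - λ² = -4` the transmission condition is equivalent to the pair of boundary
conditions on the two sides of `Σ`. -/
lemma transmission_iff {η τ lam : Γ.Smooth ℝ}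
    (h : ∀ x, η.1 x ^ 2 - τ.1 x ^ 2 - lam.1 x ^ 2 = -4) (Tp Tm : Fin 2 → Γ.Functional) :
    Γ.matMul (Complex.I • Γ.sigmaDot Γ.normal) (Tm - Tp) =
        Γ.matMul ((1 / 2 : ℂ) • Γ.interaction η τ lam) (Tm + Tp) ↔
      Γ.matMul (Complex.I • Γ.sigmaDot Γ.normal + (1 / 2 : ℂ) • Γ.interaction η τ lam) Tp = 0 ∧
      Γ.matMul (-(Complex.I • Γ.sigmaDot Γ.normal) + (1 / 2 : ℂ) • Γ.interaction η τ lam) Tm =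
        0 := by
  have hd := Γ.toComplex_sq_sub_sq h
  have ep := adjugate_mul_eq_zero_pos Γ.imag_mul_self Γ.normal_sq Γ.two_mul_half hd
  have em := adjugate_mul_eq_zero_neg Γ.imag_mul_self Γ.normal_sq Γ.two_mul_half hd
  rw [← half_smul_interaction, ← I_smul_sigmaDot_normal] at ep em
  have hB := fun w : Fin 2 → Γ.Functional => Γ.matMul_normal_eq_zero (T := w)
  -- From here on only `ep`, `em` and the injectivity of `B` matter.
  generalize Complex.I • Γ.sigmaDot Γ.normal = B, (1 / 2 : ℂ) • Γ.interaction η τ lam = A,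
    Γ.toComplex η • (1 : Matrix (Fin 2) (Fin 2) (Γ.Smooth ℂ)) = E at *
  rw [sub_eq_add_neg Tm, matMul_add, matMul_add, matMul_neg]
  constructor
  · intro ht
    -- The transmission condition, with the two sides of the curve separated.
    have hw : Γ.matMul (-B + A) Tm = -Γ.matMul (B + A) Tp := by
      rw [matMul_add_left, matMul_add_left, matMul_neg_left, eq_neg_iff_add_eq_zero]
      linear_combination (norm := module) -ht
    have h1 : Γ.matMul (E - A - B) (Γ.matMul (B + A) Tp) = 0 := by
      rw [← matMul_mul, ep, matMul_zero_left]
    have h2 : Γ.matMul (E - A + B) (Γ.matMul (B + A) Tp) = 0 := by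
      rw [← neg_eq_zero, ← matMul_neg, ← hw, ← matMul_mul, em, matMul_zero_left]
    have h3 : Γ.matMul (B + A) Tp = 0 := by
      apply hB
      -- The difference of the two adjugates is `2 B`.
      rw [matMul_sub_left] at h1
      rw [matMul_add_left] at h2
      linear_combination (norm := module) (1 / 2 : ℂ) • (h2 - h1)
    exact ⟨h3, by rw [hw, h3, neg_zero]⟩
  · rintro ⟨h1, h2⟩
    rw [matMul_add_left] at h1 h2
    rw [matMul_neg_left] at h2
    linear_combination (norm := module) -h1 - h2

lemma shellDirac_eq_orthogonalSum (m : ℝ) {η τ lam : Γ.Smooth ℝ}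
    (h : ∀ x, η.1 x ^ 2 - τ.1 x ^ 2 - lam.1 x ^ 2 = -4) :
    Γ.shellDirac m η τ lam =
      Γ.orthogonalSum (Γ.interiorDirac m η τ lam) (Γ.exteriorDirac m η τ lam) := by
  refine LinearPMap.ext (Submodule.ext fun f => ?_) fun _ _ _ => rfl
  constructor
  · rintro ⟨hp, hm, Tp, Tm, h1, h2, h3⟩
    obtain ⟨h4, h5⟩ := (Γ.transmission_iff h Tp Tm).1 h3
    exact ⟨⟨hp, Tp, h1, h4⟩, ⟨hm, Tm, h2, h5⟩⟩
  · rintro ⟨⟨hp, Tp, h1, h4⟩, ⟨hm, Tm, h2, h5⟩⟩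
    exact ⟨hp, hm, Tp, Tm, h1, h2, (Γ.transmission_iff h Tp Tm).2 ⟨h4, h5⟩⟩

/-! ### Quantum-dot and zig-zag boundary conditions -/

lemma diracBC_congr (m : ℝ) (U : TopologicalSpace.Opens Plane)
    {A B : Matrix (Fin 2) (Fin 2) (Γ.Smooth ℂ)}
    (h : ∀ T, Γ.matMul A T = 0 ↔ Γ.matMul B T = 0) : Γ.diracBC m U A = Γ.diracBC m U B := by
  refine LinearPMap.ext (Submodule.ext fun f => ?_) fun _ _ _ => rfl
  exact exists_congr fun _ => exists_congr fun T => and_congr_right fun _ => h T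

lemma sigmaDot_normal_mul_quantumDot (θ : Γ.Smooth ℝ) :
    (Complex.I • Γ.sigmaDot Γ.normal) * (1 - Γ.toComplex (Γ.cos θ) • Γ.sigmaDot Γ.tangent -
        Γ.toComplex (Γ.sin θ) • Γ.const pauli₃) =
      Complex.I • Γ.sigmaDot Γ.normal +
        (1 / 2 : ℂ) • Γ.interaction 0 (2 * Γ.cos θ) (-2 * Γ.sin θ) := by
  rw [half_smul_interaction, I_smul_sigmaDot_normal, sigmaDot_tangent, const_pauli₃,
    toComplex_mul, toComplex_mul, toComplex_neg, toComplex_two, toComplex_zero]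
  exact smul_pauliDot_mul_quantumDot Γ.imag_mul_self Γ.normal_sq Γ.two_mul_half

lemma interiorDirac_eq_quantumDot (m : ℝ) (θ : Γ.Smooth ℝ) :
    Γ.interiorDirac m 0 (2 * Γ.cos θ) (-2 * Γ.sin θ) = Γ.quantumDot m θ := by
  refine Γ.diracBC_congr m Ω fun T => ?_
  rw [← sigmaDot_normal_mul_quantumDot, matMul_mul]
  exact ⟨Γ.matMul_normal_eq_zero, fun h => by rw [h, matMul_zero]⟩

lemma matMul_zigzag_pos (T : Fin 2 → Γ.Functional) :
    Γ.matMul (Complex.I • Γ.sigmaDot Γ.normal + (1 / 2 : ℂ) • Γ.interaction 0 0 2) T = 0 ↔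
      T 0 = 0 := by
  rw [half_smul_interaction, I_smul_sigmaDot_normal, toComplex_two, toComplex_zero,
    smul_pauliDot_add_two Γ.imag_mul_self Γ.two_mul_half]
  exact Γ.matMul_lower_eq_zero_iff
    (isUnit_two_mul_sub Γ.imag_mul_self Γ.normal_sq Γ.two_mul_half) T

lemma matMul_zigzag_neg (T : Fin 2 → Γ.Functional) :
    Γ.matMul (Complex.I • Γ.sigmaDot Γ.normal + (1 / 2 : ℂ) • Γ.interaction 0 0 (-2)) T = 0 ↔
      T 1 = 0 := by
  rw [half_smul_interaction, I_smul_sigmaDot_normal, toComplex_neg, toComplex_two,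
    toComplex_zero, smul_pauliDot_add_neg_two Γ.imag_mul_self Γ.two_mul_half]
  exact Γ.matMul_upper_eq_zero_iff
    (isUnit_two_mul_add Γ.imag_mul_self Γ.normal_sq Γ.two_mul_half) T

end Shell
end DeltaShell

end

theorem theorem2p3 (Ω : TopologicalSpace.Opens DeltaShell.Plane)
    (hbounded : Bornology.IsBounded (Ω : Set DeltaShell.Plane))
    (hsimply : IsSimplyConnected (Ω : Set DeltaShell.Plane))
    (Γ : DeltaShell.Shell Ω) (m : ℝ) :
    (∀ η τ lam : Γ.Smooth ℝ,
      (∀ x, η.1 x ^ 2 - τ.1 x ^ 2 - lam.1 x ^ 2 = -4) →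
      Γ.shellDirac m η τ lam =
        Γ.orthogonalSum (Γ.interiorDirac m η τ lam) (Γ.exteriorDirac m η τ lam)) ∧
    (∀ θ : Γ.Smooth ℝ,
      (∀ x, (0 : Γ.Smooth ℝ).1 x ^ 2 - (2 * Γ.cos θ).1 x ^ 2 - (-2 * Γ.sin θ).1 x ^ 2 = -4) ∧
      Γ.interiorDirac m 0 (2 * Γ.cos θ) (-2 * Γ.sin θ) = Γ.quantumDot m θ) ∧
    (∀ f : DeltaShell.L2 Ω, f ∈ (Γ.interiorDirac m 0 0 2).domain ↔
      ∃ (hf : f ∈ DeltaShell.HSigma Ω) (T : Fin 2 → Γ.Functional),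
        Γ.IsTrace ⟨f, hf⟩ T ∧ T 0 = 0) ∧
    (∀ f : DeltaShell.L2 Ω, f ∈ (Γ.interiorDirac m 0 0 (-2)).domain ↔
      ∃ (hf : f ∈ DeltaShell.HSigma Ω) (T : Fin 2 → Γ.Functional),
        Γ.IsTrace ⟨f, hf⟩ T ∧ T 1 = 0) := by
  refine ⟨fun η τ lam h => Γ.shellDirac_eq_orthogonalSum m h,
    fun θ => ⟨fun x => ?_, Γ.interiorDirac_eq_quantumDot m θ⟩, fun f => ?_, fun f => ?_⟩
  · change (0 : ℝ) ^ 2 - (2 * Real.cos (θ.1 x)) ^ 2 - (-2 * Real.sin (θ.1 x)) ^ 2 = -4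
    linear_combination (-4) * Real.sin_sq_add_cos_sq (θ.1 x)
  · exact exists_congr fun _ => exists_congr fun T => and_congr_right fun _ =>
      Γ.matMul_zigzag_pos T
  · exact exists_congr fun _ => exists_congr fun T => and_congr_right fun _ =>
      Γ.matMul_zigzag_neg T
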